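/- **Theorem B (MA + ¬CH).** Assume Martin's Axiom (for every nonempty partially ordered set $P$ satisfying the countable chain condition and every family $\mathcal D$ of fewer than $2^{\aleph_0}$ dense subsets of $P$, there is a filter on $P$ meeting every member of $\mathcal D$) and the negation of the Continuum Hypothesis. Write $\mathbb N=\{1,2,\dots\}$ and, for each countable limit ordinal $\beta$, fix a sequence $(\alpha_n)_{n\in\mathbb N}$ of ordinals in $[0,\beta)$ that increases to $\beta$. The Schreier families $\mathrm S_\alpha$ ($\alpha<\omega_1$) of finite subsets of $\mathbb N$ are defined recursively by $$\mathrm S_0=\{\{n\}:n\in\mathbb N\},\qquad \mathrm S_{\alpha+1}=\Big\{\bigcup_{j=1}^nE_j:\ n\in\mathbb N,\ E_1,\dots,E_n\in\mathrm S_\alpha,\ n\le E_1<E_2<\dots<E_n\Big\},$$ $$\mathrm S_\beta=\{A:\ \exists n\in\mathbb N,\ n\le A\text{ and }A\in\mathrm S_{\alpha_n}\}\quad\text{for limit }\beta,$$ where $n\le A$ means $n\le\min A$ and $E<F$ means $\max E<\min F$. Let $\mathrm S_\alpha(\mathbb Z)=\{\sum_{i\in G}c_ie_i:\ G\in\mathrm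 S_\alpha,\ c_i\in\mathbb Z\}\subset c_0$, where $(e_i)_{i\in\mathbb N}$ is the canonical basis of $c_0$, and let $d_\infty$ be the metric on it induced by the norm of $c_0$. A metric space $X$ coarsely embeds into a metric space $Y$ (that is, $Y$ contains a coarse copy of $X$) if there are a map $f:X\to Y$ and non-decreasing functions $\rho,\omega:[0,\infty)\to[0,\infty)$ with $\lim_{t\to\infty}\rho(t)=\infty$ and $\rho(d_X(x,y))\le d_Y(f(x),f(y))\le\omega(d_X(x,y))$ for all $x,y\in X$. If $M$ is a separable metric space such that $(\mathrm S_\alpha(\mathbb Z),d_\infty)$ coarsely embeds into $M$ for every $\alpha<\omega_1$, then $M$ is coarsely universal for the class of all separable metric spaces: every separable metric space coarsely embeds into $M$. -/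

import Mathlib

open scoped NNReal Cardinal Ordinal ZeroAtInfty

/-! ### Coarse embeddings -/

/-- `X` `(ρ, σ)`-embeds into `Y`. -/
def ModuliEmbeds (ρ σ : ℝ≥0 → ℝ≥0) (X : Type*) (Y : Type*) [MetricSpace X] [MetricSpace Y] :
    Prop :=
  ∃ f : X → Y, ∀ x y : X,
    ρ (nndist x y) ≤ nndist (f x) (f y) ∧ nndist (f x) (f y) ≤ σ (nndist x y)

/-- `X` coarsely embeds into `Y` (equivalently, `Y` contains a coarse copy of `X`). -/
def CoarselyEmbeds (X : Type*) (Y : Type*) [MetricSpace X] [MetricSpace Y] : Prop :=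
  ∃ ρ σ : ℝ≥0 → ℝ≥0, Monotone ρ ∧ Monotone σ ∧ Filter.Tendsto ρ Filter.atTop Filter.atTop ∧
    ModuliEmbeds ρ σ X Y

universe u v

/-- `M` is coarsely universal for the class of all separable metric spaces (living in the
universe `v`). -/
def CoarselyUniversalForSeparable (M : Type u) [MetricSpace M] : Prop :=
  ∀ (X : Type v) [MetricSpace X] [TopologicalSpace.SeparableSpace X], CoarselyEmbeds X M

/-! ### Schreier families and the associated metric spaces -/

/-- A choice, for each countable limit ordinal `β`, of a sequence `(α_n)_{n ≥ 1}` of ordinals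
below `β` which increases to `β`. The values of `seq` elsewhere play no role. -/
structure LadderSystem where
  seq : Ordinal.{0} → ℕ+ → Ordinal.{0}
  seq_lt : ∀ β < ω₁, Order.IsSuccLimit β → ∀ n, seq β n < β
  monotone_seq : ∀ β < ω₁, Order.IsSuccLimit β → Monotone (seq β)
  exists_lt_seq : ∀ β < ω₁, Order.IsSuccLimit β → ∀ γ < β, ∃ n, γ < seq β n

/-- `SchreierFamily L α A` says that the finite set `A` of positive integers belongs to the
Schreier family of order `α`, built with the sequences `L` at limit ordinals. -/
inductive SchreierFamily (L : LadderSystem) : Ordinal.{0} → Finset ℕ+ → Prop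
  | zero (n : ℕ+) : SchreierFamily L 0 {n}
  | succ (α : Ordinal.{0}) (n : ℕ+) (E : Fin (n : ℕ) → Finset ℕ+)
      (mem : ∀ j, SchreierFamily L α (E j))
      (le : ∀ j, ∀ m ∈ E j, n ≤ m)
      (lt : ∀ i j, i < j → ∀ k ∈ E i, ∀ m ∈ E j, k < m) :
      SchreierFamily L (α + 1) (Finset.univ.biUnion E)
  | limit (β : Ordinal.{0}) (hβ : Order.IsSuccLimit β) (n : ℕ+) (A : Finset ℕ+)
      (le : ∀ m ∈ A, n ≤ m)
      (mem : SchreierFamily L (L.seq β n) A) :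
      SchreierFamily L β A

/-- The integer-valued Schreier space `S_α(ℤ)`: all `∑_{i ∈ G} c_i e_i` with `G` in the Schreier
family of order `α` and `c_i ∈ ℤ`. It is a subset of `c₀ = C₀(ℕ+, ℝ)` (`ℕ+` is discrete) and its
metric is the one induced by the supremum norm. -/
def SchreierSpace (L : LadderSystem) (α : Ordinal.{0}) : Set C₀(ℕ+, ℝ) :=
  {f | ∃ (G : Finset ℕ+) (c : ℕ+ → ℤ), SchreierFamily L α G ∧
    ∀ i, f i = if i ∈ G then (c i : ℝ) else 0}

/-! ### Set-theoretic axioms -/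

/-- The Continuum Hypothesis. -/
def ContinuumHypothesis : Prop := (𝔠 : Cardinal.{0}) = ℵ₁

/-- Two conditions are compatible if they have a common lower bound. -/
def Compatible {P : Type*} [PartialOrder P] (p q : P) : Prop := ∃ r, r ≤ p ∧ r ≤ q

/-- The countable chain condition: every set of pairwise incompatible elements is countable. -/
def CountableChainCondition (P : Type*) [PartialOrder P] : Prop :=
  ∀ A : Set P, (A.Pairwise fun p q => ¬ Compatible p q) → A.Countable

/-- `D` is dense in the forcing sense. -/
def ForcingDense {P : Type*} [PartialOrder P] (D : Set P) : Prop := ∀ p, ∃ q ∈ D, q ≤ p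

/-- Martin's Axiom: for every nonempty ccc partial order and every family of fewer than `2^ℵ₀`
dense subsets there is a filter meeting all of them. -/
def MartinsAxiom : Prop :=
  ∀ (P : Type) [PartialOrder P] [Nonempty P], CountableChainCondition P →
    ∀ 𝒟 : Set (Set P), #𝒟 < 𝔠 → (∀ D ∈ 𝒟, ForcingDense D) →
      ∃ F : Order.PFilter P, ∀ D ∈ 𝒟, ∃ p ∈ F, p ∈ D

/-!
Martin's Axiom, applied to Hechler forcing, bounds every family of fewer than continuum many
functions `ℕ → ℕ`, so under `¬ CH` the bounding number exceeds `ℵ₁`. Coding the moduli of a coarse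
embedding by one function `ℕ → ℕ`, the embeddings of all the spaces `S_α(ℤ)`, which may be assumed
to take values in a countable dense set, can therefore be chosen with common moduli.

Enumerate `c₀₀(ℕ; ℤ)` as `x 0, x 1, …` with `x i` supported in the first `i` coordinates, and
consider the tree of finite sequences of values at `x 0, x 1, …` compatible with these moduli. A
member of the Schreier family of order `α` can serve as the set of coordinates of the first few
`x i`, so the embedding of `S_α(ℤ)` maps the tree of such sets into the tree of values, which
therefore has rank at least `α`. A tree on a countable set with rank at least every `α < ω₁` is not
well-founded, and an infinite branch is a coarse embedding of `c₀₀(ℕ; ℤ)`.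

Finally, every separable metric space coarsely embeds into `c₀₀(ℕ; ℤ)`: take integer parts of bump
functions at all integer scales, supported near the cells of a countable partition, and subtract
their values at a base point to make the supports finite.
-/

/-! ### The bounding number under Martin's Axiom -/

section BoundingNumber

open Filter

/-- The bounding number `𝔟`: the least cardinality of a family of functions `ℕ → ℕ` which is
unbounded for eventual domination. -/
noncomputable def boundingNumber : Cardinal.{0} :=
  sInf {κ | ∃ ℱ : Set (ℕ → ℕ), #ℱ = κ ∧ ¬ ∃ g, ∀ f ∈ ℱ, f ≤ᶠ[atTop] g}

theorem exists_eventuallyLE_of_mk_lt_boundingNumber {ℱ : Set (ℕ → ℕ)}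
    (hℱ : #ℱ < boundingNumber) : ∃ g, ∀ f ∈ ℱ, f ≤ᶠ[atTop] g :=
  by_contra fun h => notMem_of_lt_csInf' hℱ ⟨ℱ, rfl, h⟩

theorem le_boundingNumber {κ : Cardinal.{0}}
    (h : ∀ ℱ : Set (ℕ → ℕ), #ℱ < κ → ∃ g, ∀ f ∈ ℱ, f ≤ᶠ[atTop] g) : κ ≤ boundingNumber := by
  refine le_csInf ⟨_, Set.univ, rfl, fun ⟨g, hg⟩ => ?_⟩ ?_
  · obtain ⟨n, hn⟩ := (hg (g + 1) trivial).exists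
    exact absurd hn (Nat.not_succ_le_self _)
  · rintro _ ⟨ℱ, rfl, hℱ⟩
    exact not_lt.1 fun hlt => hℱ (h ℱ hlt)

/-- Conditions of Hechler forcing: `stem` is a finite initial segment of the function to be added,
and the values after `stem` have to lie above `bound`. -/
@[ext] structure HechlerCondition where
  stem : List ℕ
  bound : ℕ → ℕ

namespace HechlerCondition

instance : PartialOrder HechlerCondition where
  le p q := q.stem <+: p.stem ∧ q.bound ≤ p.bound ∧
    ∀ i (hi : i < p.stem.length), q.stem.length ≤ i → q.bound i ≤ p.stem[i]
  le_refl p := ⟨List.prefix_rfl, le_rfl, fun _ hi hi' => absurd hi hi'.not_gt⟩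
  le_trans p q r hpq hqr := by
    refine ⟨hqr.1.trans hpq.1, hqr.2.1.trans hpq.2.1, fun i hi hri => ?_⟩
    rcases lt_or_ge i q.stem.length with hiq | hqi
    · exact (hqr.2.2 i hiq hri).trans_eq (hpq.1.getElem hiq)
    · exact (hqr.2.1 i).trans (hpq.2.2 i hi hqi)
  le_antisymm p q hpq hqp :=
    HechlerCondition.ext (hqp.1.eq_of_length_le hpq.1.length_le) (hqp.2.1.antisymm hpq.2.1)

instance : Nonempty HechlerCondition := ⟨⟨[], 0⟩⟩

variable {p q : HechlerCondition}

theorem le_def : p ≤ q ↔ q.stem <+: p.stem ∧ q.bound ≤ p.bound ∧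
    ∀ i (hi : i < p.stem.length), q.stem.length ≤ i → q.bound i ≤ p.stem[i] := Iff.rfl

theorem le_of_stem_eq (hstem : p.stem = q.stem) (hbound : q.bound ≤ p.bound) : p ≤ q :=
  ⟨hstem ▸ List.prefix_rfl, hbound, fun _ hi hi' => absurd (hstem ▸ hi) hi'.not_gt⟩

theorem compatible_of_stem_eq (h : p.stem = q.stem) : Compatible p q :=
  ⟨⟨p.stem, p.bound ⊔ q.bound⟩, le_of_stem_eq rfl le_sup_left, le_of_stem_eq h le_sup_right⟩

theorem countableChainCondition : CountableChainCondition HechlerCondition := by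
  intro A hA
  refine Set.countable_of_injective_of_countable_image (f := stem) ?_ (Set.to_countable _)
  intro p hp q hq hstem
  exact hA.eq hp hq (not_not_intro (compatible_of_stem_eq hstem))

theorem forcingDense_le_bound (f : ℕ → ℕ) : ForcingDense {p : HechlerCondition | f ≤ p.bound} :=
  fun p => ⟨⟨p.stem, p.bound ⊔ f⟩, (le_sup_right : f ≤ p.bound ⊔ f),
    le_of_stem_eq rfl le_sup_left⟩

theorem append_bound_le (p : HechlerCondition) :
    ⟨p.stem ++ [p.bound p.stem.length], p.bound⟩ ≤ p := by
  refine le_def.2 ⟨List.prefix_append _ _, le_rfl, fun i hi hi' => ?_⟩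
  obtain rfl : i = p.stem.length := by
    simp only [List.length_append, List.length_singleton] at hi
    lia
  simp

theorem forcingDense_le_length (n : ℕ) :
    ForcingDense {p : HechlerCondition | n ≤ p.stem.length} := by
  induction n with
  | zero => exact fun p => ⟨p, Nat.zero_le _, le_rfl⟩
  | succ n ih =>
    intro p
    obtain ⟨q, hq, hqp⟩ := ih p
    exact ⟨_, by simpa using hq, q.append_bound_le.trans hqp⟩

theorem exists_forall_bound_eventuallyLE {F : Order.PFilter HechlerCondition}
    (hF : ∀ n, ∃ p ∈ F, n < p.stem.length) :
    ∃ g : ℕ → ℕ, ∀ p ∈ F, p.bound ≤ᶠ[atTop] g := by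
  choose p hpF hp using hF
  refine ⟨fun n => (p n).stem[n]'(hp n), fun q hq => ?_⟩
  filter_upwards [eventually_ge_atTop q.stem.length] with n hn
  obtain ⟨r, -, hrp, hrq⟩ := F.directed _ (hpF n) _ hq
  rw [(le_def.1 hrp).1.getElem (hp n)]
  exact (le_def.1 hrq).2.2 n _ hn

end HechlerCondition

open HechlerCondition in
theorem MartinsAxiom.exists_eventuallyLE (hMA : MartinsAxiom) {ℱ : Set (ℕ → ℕ)}
    (hℱ : #ℱ < 𝔠) : ∃ g, ∀ f ∈ ℱ, f ≤ᶠ[atTop] g := by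
  let 𝒟 : Set (Set HechlerCondition) :=
    (fun f => {p | f ≤ p.bound}) '' ℱ ∪ Set.range fun n => {p | n ≤ p.stem.length}
  have h𝒟 : #𝒟 < 𝔠 := (Cardinal.mk_union_le _ _).trans_lt <|
    Cardinal.add_lt_of_lt Cardinal.aleph0_le_continuum (Cardinal.mk_image_le.trans_lt hℱ)
      ((Set.countable_range _).le_aleph0.trans_lt Cardinal.aleph0_lt_continuum)
  have hdense : ∀ D ∈ 𝒟, ForcingDense D := by
    rintro _ (⟨f, -, rfl⟩ | ⟨n, rfl⟩)
    exacts [forcingDense_le_bound f, forcingDense_le_length n]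
  obtain ⟨F, hF⟩ := hMA HechlerCondition countableChainCondition 𝒟 h𝒟 hdense
  obtain ⟨g, hg⟩ := exists_forall_bound_eventuallyLE fun n => hF _ (.inr ⟨n + 1, rfl⟩)
  refine ⟨g, fun f hf => ?_⟩
  obtain ⟨p, hp, hfp⟩ := hF _ (.inl ⟨f, hf, rfl⟩)
  filter_upwards [hg p hp] with n hn using (hfp n).trans hn

theorem MartinsAxiom.continuum_le_boundingNumber (hMA : MartinsAxiom) : 𝔠 ≤ boundingNumber :=
  le_boundingNumber fun _ => hMA.exists_eventuallyLE

theorem MartinsAxiom.aleph_one_lt_boundingNumber (hMA : MartinsAxiom)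
    (hCH : ¬ ContinuumHypothesis) : ℵ₁ < boundingNumber :=
  (Cardinal.aleph_one_le_continuum.lt_of_ne' hCH).trans_le hMA.continuum_le_boundingNumber

theorem exists_le_sup_const_of_eventuallyLE {f g : ℕ → ℕ} (h : f ≤ᶠ[atTop] g) :
    ∃ K : ℕ, f ≤ g ⊔ Function.const ℕ K := by
  obtain ⟨N, hN⟩ := eventually_atTop.1 h
  refine ⟨(Finset.range N).sup f, fun n => ?_⟩
  rcases lt_or_ge n N with hn | hn
  · exact le_sup_of_le_right (Finset.le_sup (Finset.mem_range.2 hn))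
  · exact le_sup_of_le_left (hN n hn)

/-- Domination only holds up to a constant `K` depending on `γ`; since `ω₁` has uncountable
cofinality, one value of `K` serves cofinally many `γ`, hence all of them by `hanti`. -/
theorem exists_forall_lt_omega_one_of_aleph_one_lt_boundingNumber (h𝔟 : ℵ₁ < boundingNumber)
    {P : Ordinal.{0} → (ℕ → ℕ) → Prop} (hanti : ∀ g, Antitone (P · g))
    (hmono : ∀ γ, Monotone (P γ)) (h : ∀ γ < ω₁, ∃ g, P γ g) : ∃ g, ∀ γ < ω₁, P γ g := by
  choose! f hf using h
  have hcard : #(f '' Set.Iio ω₁) < boundingNumber := by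
    refine lt_of_le_of_lt ?_ h𝔟
    have hle := Cardinal.mk_image_le_lift (f := f) (s := Set.Iio ω₁)
    rw [Cardinal.mk_Iio_ordinal] at hle
    simpa using hle
  obtain ⟨g, hg⟩ := exists_eventuallyLE_of_mk_lt_boundingNumber hcard
  by_contra! hcon
  choose γ hγ hPγ using fun K : ℕ => hcon (g ⊔ Function.const ℕ K)
  have hsup : ⨆ K, γ K < ω₁ := Ordinal.iSup_lt_omega_one hγ
  obtain ⟨K, hK⟩ := exists_le_sup_const_of_eventuallyLE (hg _ ⟨_, hsup, rfl⟩)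
  exact hPγ K (hanti _ (Ordinal.le_iSup γ K) (hmono _ hK (hf _ hsup)))

end BoundingNumber

/-! ### Coarse embeddings and their gauges -/

section Gauge

open Filter

theorem nndist_le_nndist_add_two_mul {X : Type*} [PseudoMetricSpace X] {x y x' y' : X} {r : ℝ≥0}
    (hx : nndist x x' ≤ r) (hy : nndist y y' ≤ r) : nndist x y ≤ nndist x' y' + 2 * r :=
  calc nndist x y ≤ nndist x x' + nndist x' y' + nndist y' y :=
        (nndist_triangle x y' y).trans (by gcongr; exact nndist_triangle x x' y')
    _ ≤ r + nndist x' y' + r := by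
        rw [nndist_comm y' y]
        gcongr
    _ = nndist x' y' + 2 * r := by ring

namespace CoarselyEmbeds

variable {X Y Z : Type*} [MetricSpace X] [MetricSpace Y] [MetricSpace Z]

theorem of_isometry {f : X → Y} (hf : Isometry f) : CoarselyEmbeds X Y :=
  ⟨id, id, monotone_id, monotone_id, tendsto_id, f, fun x y => by simp [hf.nndist_eq]⟩

theorem trans (hXY : CoarselyEmbeds X Y) (hYZ : CoarselyEmbeds Y Z) : CoarselyEmbeds X Z := by
  obtain ⟨ρ₁, σ₁, hρ₁, hσ₁, hlim₁, f₁, hf₁⟩ := hXY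
  obtain ⟨ρ₂, σ₂, hρ₂, hσ₂, hlim₂, f₂, hf₂⟩ := hYZ
  exact ⟨ρ₂ ∘ ρ₁, σ₂ ∘ σ₁, hρ₂.comp hρ₁, hσ₂.comp hσ₁, hlim₂.comp hlim₁, f₂ ∘ f₁, fun x y =>
    ⟨(hρ₂ (hf₁ x y).1).trans (hf₂ _ _).1, (hf₂ _ _).2.trans (hσ₂ (hf₁ x y).2)⟩⟩

theorem into_dense {D : Set Y} (hD : Dense D) (h : CoarselyEmbeds X Y) : CoarselyEmbeds X D := by
  obtain ⟨ρ, σ, hρ, hσ, hlim, f, hf⟩ := h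
  choose f' hf'D hf' using fun x => hD.exists_dist_lt (f x) one_pos
  have hff' : ∀ x, nndist (f x) (f' x) ≤ 1 := fun x => (hf' x).le
  have hf'f : ∀ x, nndist (f' x) (f x) ≤ 1 := fun x => nndist_comm (f x) (f' x) ▸ hff' x
  refine ⟨fun t => ρ t - 2 * 1, fun t => σ t + 2 * 1, fun s t hst => tsub_le_tsub_right (hρ hst) _,
    fun s t hst => add_le_add_left (hσ hst) _, ?_,
    fun x => ⟨f' x, hf'D x⟩, fun x y => ⟨tsub_le_iff_right.2 ?_, ?_⟩⟩
  · refine tendsto_atTop.2 fun b => ?_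
    filter_upwards [hlim.eventually_ge_atTop (b + 2 * 1)] with t using le_tsub_of_add_le_right
  · exact (hf x y).1.trans (nndist_le_nndist_add_two_mul (hff' x) (hff' y))
  · exact (nndist_le_nndist_add_two_mul (hf'f x) (hf'f y)).trans (add_le_add_left (hf x y).2 _)

end CoarselyEmbeds

/-- The numbers `s` and `t` bound each other through `g`. Letting the same `g : ℕ → ℕ` control both
directions encodes the two moduli of a coarse embedding in a single element of `ℕ → ℕ`. -/
def ComparableVia (g : ℕ → ℕ) (s t : ℝ≥0) : Prop := t ≤ g ⌈s⌉₊ ∧ s ≤ g ⌈t⌉₊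

theorem ComparableVia.mono {g g' : ℕ → ℕ} {s t : ℝ≥0} (h : ComparableVia g s t) (hg : g ≤ g') :
    ComparableVia g' s t :=
  ⟨h.1.trans (Nat.cast_le.2 (hg _)), h.2.trans (Nat.cast_le.2 (hg _))⟩

theorem exists_comparableVia_of_moduli {ρ σ : ℝ≥0 → ℝ≥0} (hσ : Monotone σ)
    (hρ : Tendsto ρ atTop atTop) :
    ∃ g, ∀ s t, ρ s ≤ t → t ≤ σ s → ComparableVia g s t := by
  have hbound : ∀ n : ℕ, ∃ m : ℕ, ∀ s, ρ s ≤ n → s ≤ m := fun n => by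
    obtain ⟨s₀, hs₀⟩ := eventually_atTop.1 (hρ.eventually_gt_atTop (n : ℝ≥0))
    exact ⟨⌈s₀⌉₊, fun s hs => (not_le.1 fun h => (hs₀ s h).not_ge hs).le.trans (Nat.le_ceil s₀)⟩
  choose m hm using hbound
  refine ⟨fun n => ⌈σ n⌉₊ ⊔ m n, fun s t hρt htσ => ⟨?_, ?_⟩⟩
  · calc t ≤ σ ⌈s⌉₊ := htσ.trans (hσ (Nat.le_ceil s))
      _ ≤ (⌈σ ⌈s⌉₊⌉₊ ⊔ m ⌈s⌉₊ : ℕ) := (Nat.le_ceil _).trans (Nat.cast_le.2 le_sup_left)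
  · calc s ≤ m ⌈t⌉₊ := hm _ s (hρt.trans (Nat.le_ceil t))
      _ ≤ (⌈σ ⌈t⌉₊⌉₊ ⊔ m ⌈t⌉₊ : ℕ) := Nat.cast_le.2 le_sup_right

theorem exists_moduli_of_comparableVia (g : ℕ → ℕ) :
    ∃ ρ σ : ℝ≥0 → ℝ≥0, Monotone ρ ∧ Monotone σ ∧ Tendsto ρ atTop atTop ∧
      ∀ s t, ComparableVia g s t → ρ s ≤ t ∧ t ≤ σ s := by
  let σ : ℝ≥0 → ℝ≥0 := fun s => (partialSups (g ⊔ id) ⌈s⌉₊ : ℕ)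
  have hσ : Monotone σ := fun _ _ hst =>
    Nat.cast_le.2 ((partialSups _).monotone (Nat.ceil_mono hst))
  have hgσ : ∀ s, (g ⌈s⌉₊ : ℝ≥0) ≤ σ s := fun s =>
    Nat.cast_le.2 (le_sup_left.trans (le_partialSups (g ⊔ id) ⌈s⌉₊))
  have hidσ : ∀ s, s ≤ σ s := fun s =>
    (Nat.le_ceil s).trans (Nat.cast_le.2 (le_sup_right.trans (le_partialSups (g ⊔ id) ⌈s⌉₊)))
  have hne : ∀ s, {t | s ≤ σ t}.Nonempty := fun s => ⟨s, hidσ s⟩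
  -- The lower modulus is the generalized inverse of the upper one.
  refine ⟨fun s => sInf {t | s ≤ σ t}, σ, fun s s' hs => ?_, hσ, tendsto_atTop.2 fun b => ?_,
    fun s t h => ⟨csInf_le' (h.2.trans (hgσ t)), h.1.trans (hgσ s)⟩⟩
  · exact csInf_le_csInf (OrderBot.bddBelow _) (hne s') fun t ht => hs.trans ht
  · filter_upwards [eventually_gt_atTop (σ b)] with s hs
    exact le_csInf (hne s) fun t ht => le_of_not_gt fun htb => (ht.trans (hσ htb.le)).not_gt hs

/-- `f` is a coarse embedding whose two moduli are controlled by `g`. -/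
def IsGaugeEmbedding {X Y : Type*} [MetricSpace X] [MetricSpace Y] (g : ℕ → ℕ) (f : X → Y) : Prop :=
  ∀ x y, ComparableVia g (nndist x y) (nndist (f x) (f y))

theorem coarselyEmbeds_iff_exists_isGaugeEmbedding {X Y : Type*} [MetricSpace X] [MetricSpace Y] :
    CoarselyEmbeds X Y ↔ ∃ (g : ℕ → ℕ) (f : X → Y), IsGaugeEmbedding g f := by
  constructor
  · rintro ⟨ρ, σ, -, hσ, hlim, f, hf⟩
    obtain ⟨g, hg⟩ := exists_comparableVia_of_moduli hσ hlim
    exact ⟨g, f, fun x y => hg _ _ (hf x y).1 (hf x y).2⟩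
  · rintro ⟨g, f, hf⟩
    obtain ⟨ρ, σ, hρ, hσ, hlim, h⟩ := exists_moduli_of_comparableVia g
    exact ⟨ρ, σ, hρ, hσ, hlim, f, fun x y => h _ _ (hf x y)⟩

end Gauge

/-! ### Finitely supported integer vectors in `c₀` -/

section FinitelySupported

variable {ι : Type*} [TopologicalSpace ι] [DiscreteTopology ι]

/-- A finitely supported integer vector on a discrete index set, seen as an element of `c₀`. -/
noncomputable def toC₀ (v : ι →₀ ℤ) : C₀(ι, ℝ) where
  toFun i := v i
  continuous_toFun := continuous_of_discreteTopology
  zero_at_infty' := by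
    rw [Filter.cocompact_eq_cofinite]
    refine tendsto_const_nhds.congr' ?_
    filter_upwards [v.support.finite_toSet.compl_mem_cofinite] with i hi
    exact (Int.cast_eq_zero.2 (by simpa using hi)).symm

theorem nndist_toC₀_le_iff {v w : ι →₀ ℤ} {r : ℝ≥0} :
    nndist (toC₀ v) (toC₀ w) ≤ r ↔ ∀ i, nndist (v i) (w i) ≤ r := by
  rw [← NNReal.coe_le_coe, coe_nndist, ← ZeroAtInftyContinuousMap.dist_toBCF_eq_dist,
    BoundedContinuousFunction.dist_le r.coe_nonneg]
  exact Iff.rfl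

variable (ι) in
/-- The space `c₀₀(ι; ℤ)` of finitely supported integer vectors, with the supremum metric. -/
def c₀₀Int : Set C₀(ι, ℝ) := Set.range toC₀

theorem toC₀_mem_schreierSpace {L : LadderSystem} {α : Ordinal.{0}} {G : Finset ℕ+}
    (hG : SchreierFamily L α G) {v : ℕ+ →₀ ℤ} (hv : v.support ⊆ G) :
    toC₀ v ∈ SchreierSpace L α := by
  refine ⟨G, v, hG, fun i => ?_⟩
  split_ifs with hi
  · rfl
  · exact Int.cast_eq_zero.2 (Finsupp.notMem_support_iff.1 fun h => hi (hv h))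

end FinitelySupported

/-! ### Separable spaces embed into `c₀₀(ℕ; ℤ)` -/

theorem dist_floor_floor_le (a b : ℝ) : dist ⌊a⌋ ⌊b⌋ ≤ dist a b + 1 := by
  rw [Int.dist_eq, Real.dist_eq, abs_sub_le_iff]
  have hab := abs_sub_le_iff.1 (le_refl |a - b|)
  constructor <;>
    linarith [Int.floor_le a, Int.lt_floor_add_one a, Int.floor_le b, Int.lt_floor_add_one b]

section Bump

variable {X : Type*} [PseudoMetricSpace X] {x : ℕ → X} {r : ℝ} {i j : ℕ} {y z w : X}

/-- The points of the ball of radius `2 * r` around `x j` which lie in none of the earlier balls. -/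
def cell (x : ℕ → X) (r : ℝ) : ℕ → Set X := disjointed fun i => Metric.ball (x i) (2 * r)

/-- The bump function of height `r` over the `j`-th cell. If that cell is empty then
`Metric.infDist` vanishes and the bump function is the constant `r`. -/
noncomputable def bump (x : ℕ → X) (r : ℝ) (j : ℕ) (z : X) : ℝ :=
  max 0 (r - Metric.infDist z (cell x r j))

theorem dist_bump_bump_le (x : ℕ → X) (r : ℝ) (j : ℕ) (y z : X) :
    dist (bump x r j y) (bump x r j z) ≤ dist y z := by
  have h : LipschitzWith (0 + 1) (bump x r j) :=
    ((LipschitzWith.const r).sub (Metric.lipschitz_infDist_pt _)).const_max 0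
  simpa using h.dist_le_mul y z

theorem bump_eq_radius_of_mem_cell (hr : 0 ≤ r) (hz : z ∈ cell x r j) : bump x r j z = r := by
  rw [bump, Metric.infDist_zero_of_mem hz, sub_zero, max_eq_right hr]

theorem disjoint_ball_cell (hij : i < j) (hz : dist z (x i) ≤ r) :
    Disjoint (Metric.ball z r) (cell x r j) := by
  have hball : Metric.ball z r ⊆ Metric.ball (x i) (2 * r) :=
    Metric.ball_subset_ball' (by linarith)
  refine Set.disjoint_of_subset hball subset_rfl (Set.disjoint_left.2 fun p hpi hpj => ?_)
  rw [cell, disjointed_apply] at hpj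
  exact hpj.2 (Finset.le_sup (f := fun i => Metric.ball (x i) (2 * r)) (Finset.mem_Iio.2 hij) hpi)

theorem bump_eq_zero_of_disjoint (hne : (cell x r j).Nonempty)
    (hz : Disjoint (Metric.ball z r) (cell x r j)) : bump x r j z = 0 := by
  refine max_eq_left (sub_nonpos.2 ((Metric.le_infDist hne).2 fun p hp => ?_))
  rw [dist_comm]
  exact not_lt.1 fun hlt => Set.disjoint_left.1 hz hlt hp

theorem bump_eq_bump_of_disjoint (hz : Disjoint (Metric.ball z r) (cell x r j))
    (hw : Disjoint (Metric.ball w r) (cell x r j)) : bump x r j z = bump x r j w := by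
  rcases (cell x r j).eq_empty_or_nonempty with hempty | hne
  · simp only [bump, hempty, Metric.infDist_empty]
  · rw [bump_eq_zero_of_disjoint hne hz, bump_eq_zero_of_disjoint hne hw]

theorem bump_eq_bump_zero (hz : dist z (x 0) ≤ r) (hr : 0 < r) (j : ℕ) :
    bump x r j z = bump x r j (x 0) := by
  have hx₀ : dist (x 0) (x 0) ≤ r := by simpa using hr.le
  rcases j.eq_zero_or_pos with rfl | hj
  · have hmem : ∀ w, dist w (x 0) ≤ r → w ∈ cell x r 0 := fun w hw => by
      rw [cell, disjointed_zero, Metric.mem_ball]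
      linarith
    rw [bump_eq_radius_of_mem_cell hr.le (hmem z hz), bump_eq_radius_of_mem_cell hr.le (hmem _ hx₀)]
  · exact bump_eq_bump_of_disjoint (disjoint_ball_cell hj hz) (disjoint_ball_cell hj hx₀)

theorem exists_bump_separating (hx : DenseRange x) (hr : 0 < r) (h : 5 * r ≤ dist y z) :
    ∃ j, bump x r j y = r ∧ bump x r j z = 0 := by
  obtain ⟨j, hj⟩ : ∃ j, y ∈ cell x r j := by
    rw [← Set.mem_iUnion, cell, iUnion_disjointed, Set.mem_iUnion]
    exact hx.exists_dist_lt y (by linarith)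
  have hball : ∀ p ∈ cell x r j, dist p (x j) < 2 * r := fun p hp => disjointed_subset _ j hp
  refine ⟨j, bump_eq_radius_of_mem_cell hr.le hj,
    bump_eq_zero_of_disjoint ⟨y, hj⟩ (Set.disjoint_left.2 fun p hpz hpj => ?_)⟩
  linarith [hball y hj, hball p hpj, dist_triangle_right y p (x j), dist_triangle y p z,
    Metric.mem_ball.1 hpz]

/-- The integer parts of the bump functions of positive integer radii, normalized to vanish at
`x 0`. The coordinate `n` codes the pair of the radius, minus one, and the index of the cell. -/
noncomputable def bumpCoordinate (x : ℕ → X) (z : X) (n : ℕ) : ℤ :=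
  ⌊bump x (n.unpair.1 + 1) n.unpair.2 z⌋ - ⌊bump x (n.unpair.1 + 1) n.unpair.2 (x 0)⌋

theorem finite_support_bumpCoordinate (hx : DenseRange x) (z : X) :
    (Function.support (bumpCoordinate x z)).Finite := by
  choose i hi using fun k : ℕ => hx.exists_dist_lt z (Nat.cast_add_one_pos (α := ℝ) k)
  refine (((Finset.range ⌈dist z (x 0)⌉₊).biUnion fun k =>
    (Finset.range (i k + 1)).image (Nat.pair k)).finite_toSet).subset fun n hn => ?_
  have hbump : bump x (n.unpair.1 + 1) n.unpair.2 z ≠ bump x (n.unpair.1 + 1) n.unpair.2 (x 0) :=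
    fun h => hn (by rw [bumpCoordinate, h, sub_self])
  have hradius : n.unpair.1 < ⌈dist z (x 0)⌉₊ := by
    refine not_le.1 fun hle => hbump (bump_eq_bump_zero ?_ (Nat.cast_add_one_pos _) _)
    exact (Nat.ceil_le.1 hle).trans (lt_add_one _).le
  have hindex : n.unpair.2 < i n.unpair.1 + 1 := by
    refine not_le.1 fun hle => hbump (bump_eq_bump_of_disjoint
      (disjoint_ball_cell hle (hi _).le) (disjoint_ball_cell (i := 0) (by lia) ?_))
    simpa using (Nat.cast_add_one_pos _).le
  simp only [Finset.coe_biUnion, Set.mem_iUnion, Finset.mem_coe, Finset.mem_range, Finset.mem_image]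
  exact ⟨_, hradius, _, hindex, n.pair_unpair⟩

theorem dist_bumpCoordinate_le (x : ℕ → X) (y z : X) (n : ℕ) :
    dist (bumpCoordinate x y n) (bumpCoordinate x z n) ≤ dist y z + 1 := by
  rw [bumpCoordinate, bumpCoordinate, dist_sub_right]
  exact (dist_floor_floor_le _ _).trans (by gcongr; exact dist_bump_bump_le ..)

theorem dist_le_of_dist_bumpCoordinate_le (hx : DenseRange x) {k : ℕ}
    (h : ∀ n, dist (bumpCoordinate x y n) (bumpCoordinate x z n) ≤ k) :
    dist y z ≤ 5 * (k + 1) := by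
  by_contra! hlt
  obtain ⟨j, hy, hz⟩ := exists_bump_separating hx (Nat.cast_add_one_pos k) hlt.le
  have hk := h (Nat.pair k j)
  rw [bumpCoordinate, bumpCoordinate, dist_sub_right, Nat.unpair_pair, hy, hz, Int.floor_zero,
    Int.floor_add_one, Int.floor_natCast, Int.dist_eq, Int.cast_zero, sub_zero] at hk
  push_cast at hk
  linarith [le_abs_self ((k : ℝ) + 1)]

/-- A separable metric space, mapped to `c₀₀(ℕ; ℤ)` by its bump coordinates. -/
noncomputable def bumpMap (hx : DenseRange x) (z : X) : c₀₀Int ℕ :=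
  ⟨toC₀ (Finsupp.ofSupportFinite _ (finite_support_bumpCoordinate hx z)), _, rfl⟩

end Bump

theorem isGaugeEmbedding_bumpMap {X : Type*} [MetricSpace X] {x : ℕ → X} (hx : DenseRange x) :
    IsGaugeEmbedding (fun n => 5 * (n + 1)) (bumpMap hx) := by
  refine fun y z => ⟨?_, ?_⟩
  · calc nndist (bumpMap hx y) (bumpMap hx z) ≤ nndist y z + 1 :=
          nndist_toC₀_le_iff.2 (dist_bumpCoordinate_le x y z)
      _ ≤ (⌈nndist y z⌉₊ + 1 : ℕ) := by
          push_cast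
          gcongr
          exact Nat.le_ceil _
      _ ≤ (5 * (⌈nndist y z⌉₊ + 1) : ℕ) := Nat.cast_le.2 (Nat.le_mul_of_pos_left _ (by norm_num))
  · have hcoord := nndist_toC₀_le_iff.1 (Nat.le_ceil (nndist (bumpMap hx y) (bumpMap hx z)))
    exact_mod_cast dist_le_of_dist_bumpCoordinate_le hx hcoord

theorem coarselyEmbeds_c₀₀Int (X : Type*) [MetricSpace X] [TopologicalSpace.SeparableSpace X] :
    CoarselyEmbeds X (c₀₀Int ℕ) := by
  rcases isEmpty_or_nonempty X with hX | hX
  · exact .of_isometry (f := isEmptyElim) isometry_subsingleton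
  · exact coarselyEmbeds_iff_exists_isGaugeEmbedding.2
      ⟨_, _, isGaugeEmbedding_bumpMap (TopologicalSpace.denseRange_denseSeq X)⟩

/-! ### Ranks of trees of finite sequences -/

/-- `l'` extends `l` by one entry, and all pairs of entries of `l'`, at positions `i` and `j`,
satisfy `Q i j`. The infinite branches of this relation are the sequences all of whose pairs of
terms satisfy `Q`. -/
def GoodExtension {β : Type*} (Q : ℕ → ℕ → β → β → Prop) (l' l : List β) : Prop :=
  (∃ b, l' = l ++ [b]) ∧ ∀ i j (hi : i < l'.length) (hj : j < l'.length), Q i j l'[i] l'[j]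

theorem exists_branch_of_not_wellFounded {β : Type*} {Q : ℕ → ℕ → β → β → Prop}
    (h : ¬ WellFounded (GoodExtension Q)) : ∃ u : ℕ → β, ∀ i j, Q i j (u i) (u j) := by
  rw [wellFounded_iff_isEmpty_descending_chain, not_isEmpty_iff] at h
  obtain ⟨f, hf⟩ := h
  choose hext hgood using hf
  choose b hb using hext
  have hlen : ∀ n, n ≤ (f n).length := fun n => by
    induction n with
    | zero => exact Nat.zero_le _
    | succ n ih => simpa [hb] using ih
  have hprefix : ∀ {m n}, m ≤ n → f m <+: f n := fun hmn => by
    induction hmn with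
    | refl => exact List.prefix_rfl
    | step _ ih => exact ih.trans (hb _ ▸ List.prefix_append _ _)
  refine ⟨fun i => (f (i + 1))[i]'(hlen (i + 1)), fun i j => ?_⟩
  have hi : f (i + 1) <+: f (max i j + 1) := hprefix (by lia)
  have hj : f (j + 1) <+: f (max i j + 1) := hprefix (by lia)
  convert hgood (max i j) i j ((hlen (i + 1)).trans hi.length_le)
    ((hlen (j + 1)).trans hj.length_le) using 1
  exacts [hi.getElem _, hj.getElem _]

theorem rank_lt_omega_one {β : Type u} [Countable β] (r : β → β → Prop) [IsWellFounded β r]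
    (b : β) : IsWellFounded.rank r b < ω₁ := by
  induction b using IsWellFounded.induction r with
  | _ b ih =>
    rw [IsWellFounded.rank_eq]
    exact Ordinal.iSup_lt_omega_one fun c => (Cardinal.isSuccLimit_omega 1).succ_lt (ih c c.2)

/-! ### Schreier families have large rank -/

namespace SchreierFamily

variable {L : LadderSystem} {α : Ordinal.{0}}

theorem add_one {G : Finset ℕ+} (hG : SchreierFamily L α G) : SchreierFamily L (α + 1) G := by
  have h : SchreierFamily L (α + 1) ((Finset.univ : Finset (Fin 1)).biUnion fun _ => G) :=
    .succ α 1 _ (fun _ => hG) (fun _ _ _ => one_le)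
      fun i j hij => absurd hij (Subsingleton.elim (α := Fin 1) i j).not_lt
  simpa using h

protected theorem singleton (hα : α < ω₁) (n : ℕ+) : SchreierFamily L α {n} := by
  induction α using Ordinal.limitRecOn with
  | zero => exact .zero n
  | add_one α ih => exact (ih ((lt_add_one α).trans hα)).add_one
  | limit β hβ ih =>
    have hlt := L.seq_lt β hα hβ 1
    exact .limit β hβ 1 _ (fun _ _ => one_le) (ih _ hlt (hlt.trans hα))

protected theorem insert (hα : α < ω₁) {n : ℕ+} (hn : 2 ≤ n) {G : Finset ℕ+}
    (hG : SchreierFamily L α G) (hlt : ∀ m ∈ G, n < m) : SchreierFamily L (α + 1) (insert n G) := by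
  have h : SchreierFamily L (α + 1)
      ((Finset.univ : Finset (Fin 2)).biUnion (![{n}, G] : Fin 2 → Finset ℕ+)) := by
    refine .succ α 2 _ (Fin.forall_fin_two.2 ⟨.singleton hα n, hG⟩)
      (Fin.forall_fin_two.2 ⟨by simpa using hn, fun m hm => hn.trans (hlt m hm).le⟩) ?_
    refine Fin.forall_fin_two.2 ⟨Fin.forall_fin_two.2 ⟨fun h => absurd h (lt_irrefl _), ?_⟩,
      Fin.forall_fin_two.2 ⟨fun h => absurd h (by decide), fun h => absurd h (lt_irrefl _)⟩⟩
    exact fun _ k hk m hm => Finset.mem_singleton.1 hk ▸ hlt m hm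
  simpa [Finset.univ_fin2] using h

end SchreierFamily

/-- The tree of all repetition-free sequences whose entries belong to a common member of the
Schreier family of order `α` with minimum at least `N`. -/
def SchreierTree (L : LadderSystem) (α : Ordinal.{0}) (N : ℕ+) : Set (List ℕ+) :=
  {l | l.Nodup ∧ ∃ G, SchreierFamily L α G ∧ l.toFinset ⊆ G ∧ ∀ m ∈ G, N ≤ m}

section SchreierTree

variable {L : LadderSystem} {α : Ordinal.{0}} {N : ℕ+} {l : List ℕ+}

theorem nil_mem_schreierTree (hα : α < ω₁) : [] ∈ SchreierTree L α N :=
  ⟨List.nodup_nil, {N}, .singleton hα N, by simp, by simp⟩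

theorem cons_mem_schreierTree (hα : α < ω₁) {k : ℕ+} (hk : 2 ≤ k) (hN : N ≤ k)
    (hl : l ∈ SchreierTree L α (k + 1)) : k :: l ∈ SchreierTree L (α + 1) N := by
  obtain ⟨hnodup, G, hG, hlG, hkG⟩ := hl
  have hlt : ∀ m ∈ G, k < m := fun m hm => PNat.add_one_le_iff.1 (hkG m hm)
  refine ⟨List.nodup_cons.2 ⟨fun hkl => ?_, hnodup⟩, insert k G, hG.insert hα hk hlt, ?_, ?_⟩
  · exact (hlt k (hlG (List.mem_toFinset.2 hkl))).false
  · rw [List.toFinset_cons]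
    exact Finset.insert_subset_insert k hlG
  · exact (Finset.forall_mem_insert ..).2 ⟨hN, fun m hm => hN.trans (hlt m hm).le⟩

theorem mem_schreierTree_of_isSuccLimit {β : Ordinal.{0}} (hβ : Order.IsSuccLimit β) {n : ℕ+}
    (hl : l ∈ SchreierTree L (L.seq β n) (max N n)) : l ∈ SchreierTree L β N := by
  obtain ⟨hnodup, G, hG, hlG, hG'⟩ := hl
  exact ⟨hnodup, G, .limit β hβ n G (fun m hm => le_of_max_le_right (hG' m hm)) hG, hlG,
    fun m hm => le_of_max_le_left (hG' m hm)⟩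

theorem lift_le_rank_of_schreierTree {T : Type u} {r : T → T → Prop} [IsWellFounded T r]
    (hα : α < ω₁) {Θ : List ℕ+ → T}
    (hΘ : ∀ l n, l ++ [n] ∈ SchreierTree L α N → r (Θ (l ++ [n])) (Θ l)) :
    Ordinal.lift.{u} α ≤ IsWellFounded.rank r (Θ []) := by
  induction α using Ordinal.limitRecOn generalizing N Θ with
  | zero => simp
  | add_one α ih =>
    have hα' := (lt_add_one α).trans hα
    let k := max N 2
    have hcons : ∀ {l}, l ∈ SchreierTree L α (k + 1) → k :: l ∈ SchreierTree L (α + 1) N :=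
      cons_mem_schreierTree hα' (le_max_right _ _) (le_max_left _ _)
    have hrank : Ordinal.lift.{u} α ≤ IsWellFounded.rank r (Θ [k]) :=
      ih hα' (Θ := fun l => Θ (k :: l)) fun l n hln => hΘ (k :: l) n (hcons hln)
    rw [Ordinal.lift_add_one, Order.add_one_le_iff]
    exact hrank.trans_lt
      (IsWellFounded.rank_lt_of_rel (hΘ [] k (hcons (nil_mem_schreierTree hα'))))
  | limit β hβ ih =>
    refine le_of_forall_lt fun δ hδ => ?_
    obtain ⟨γ, hγ, rfl⟩ := Ordinal.lt_lift_iff.1 hδ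
    obtain ⟨n, hn⟩ := L.exists_lt_seq β hα hβ γ hγ
    have hlt := L.seq_lt β hα hβ n
    exact (Ordinal.lift_lt.2 hn).trans_le (ih _ hlt (hlt.trans hα) fun l m hlm =>
      hΘ l m (mem_schreierTree_of_isSuccLimit hβ hlm))

theorem not_wellFounded_of_schreierTree {T : Type u} [Countable T] {r : T → T → Prop} {b : T}
    (h : ∀ γ < ω₁, ∃ α ∈ Set.Ico γ ω₁, ∃ Θ : List ℕ+ → T, Θ [] = b ∧
      ∀ l n, l ++ [n] ∈ SchreierTree L α N → r (Θ (l ++ [n])) (Θ l)) : ¬ WellFounded r := by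
  intro hwf
  have : IsWellFounded T r := ⟨hwf⟩
  obtain ⟨γ, hγω, hγ⟩ : ∃ γ < (ω₁ : Ordinal.{0}), Ordinal.lift.{u} γ = IsWellFounded.rank r b := by
    rw [← Ordinal.lt_lift_iff, Ordinal.lift_omega, Ordinal.lift_one]
    exact rank_lt_omega_one r b
  obtain ⟨α, ⟨hγα, hα⟩, Θ, rfl, hΘ⟩ := h _ ((Cardinal.isSuccLimit_omega 1).succ_lt hγω)
  have hrank := lift_le_rank_of_schreierTree hα hΘ
  rw [← hγ, Ordinal.lift_le] at hrank
  exact (Order.succ_le_iff.1 hγα).not_ge hrank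

end SchreierTree

/-! ### From Schreier spaces to `c₀₀(ℕ; ℤ)` -/

theorem IsGaugeEmbedding.exists_extension {X Y : Type*} [MetricSpace X] [MetricSpace Y] {S : Set X}
    (hS : S.Nonempty) {g : ℕ → ℕ} {f : S → Y} (hf : IsGaugeEmbedding g f) :
    ∃ F : X → Y, ∀ x ∈ S, ∀ y ∈ S, ComparableVia g (nndist x y) (nndist (F x) (F y)) := by
  have : Nonempty Y := ⟨f ⟨_, hS.some_mem⟩⟩
  obtain ⟨F, rfl⟩ := Subtype.val_injective.surjective_comp_right f
  exact ⟨F, fun x hx y hy => hf ⟨x, hx⟩ ⟨y, hy⟩⟩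

theorem schreierSpace_nonempty (L : LadderSystem) {α : Ordinal.{0}} (hα : α < ω₁) :
    (SchreierSpace L α).Nonempty :=
  ⟨toC₀ 0, toC₀_mem_schreierSpace (.singleton hα 1) (by simp)⟩

theorem exists_surjective_finsupp_eq_zero_of_le :
    ∃ x : ℕ → ℕ →₀ ℤ, Function.Surjective x ∧ ∀ i j, i ≤ j → x i j = 0 := by
  obtain ⟨e, he⟩ := exists_surjective_nat (ℕ →₀ ℤ)
  refine ⟨fun i => (e i.unpair.1).filter (· < i), fun v => ?_,
    fun i j hij => Finsupp.filter_apply_neg _ _ hij.not_gt⟩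
  obtain ⟨k, rfl⟩ := he v
  obtain ⟨N, hN⟩ := (e k).support.exists_nat_subset_range
  refine ⟨Nat.pair k N, ?_⟩
  simp only [Nat.unpair_pair]
  refine Finsupp.filter_eq_self_iff _ _ |>.2 fun i hi => ?_
  exact (Finset.mem_range.1 (hN (Finsupp.mem_support_iff.2 hi))).trans_le (Nat.right_le_pair _ _)

section Spread

variable {ι : Type*} [DecidableEq ι] {l : List ι} {v w : ℕ →₀ ℤ}

/-- The vector whose coordinate at the `k`-th entry of `l` is `v k`. -/
noncomputable def spread (l : List ι) (v : ℕ →₀ ℤ) : ι →₀ ℤ :=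
  Finsupp.onFinset l.toFinset (fun i => if i ∈ l then v (l.idxOf i) else 0) fun _ hi =>
    List.mem_toFinset.2 (of_not_not fun h => hi (if_neg h))

theorem support_spread_subset : (spread l v).support ⊆ l.toFinset :=
  Finsupp.support_onFinset_subset

theorem spread_apply_of_mem {i : ι} (hi : i ∈ l) : spread l v i = v (l.idxOf i) := if_pos hi

theorem spread_apply_of_notMem {i : ι} (hi : i ∉ l) : spread l v i = 0 := if_neg hi

theorem spread_append_singleton {n : ι} (hn : n ∉ l) (hv : v l.length = 0) :
    spread (l ++ [n]) v = spread l v := by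
  ext i
  by_cases hi : i ∈ l
  · rw [spread_apply_of_mem hi, spread_apply_of_mem (List.mem_append_left _ hi),
      List.idxOf_append_of_mem hi]
  rw [spread_apply_of_notMem hi]
  obtain rfl | hin := eq_or_ne i n
  · rw [spread_apply_of_mem (by simp), List.idxOf_append_of_notMem hn]
    simpa using hv
  · exact spread_apply_of_notMem (by simp [hi, hin])

theorem nndist_toC₀_spread [TopologicalSpace ι] [DiscreteTopology ι] (hl : l.Nodup)
    (hv : ∀ i, l.length ≤ i → v i = 0) (hw : ∀ i, l.length ≤ i → w i = 0) :
    nndist (toC₀ (spread l v)) (toC₀ (spread l w)) = nndist (toC₀ v) (toC₀ w) := by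
  refine eq_of_forall_ge_iff fun r => ?_
  rw [nndist_toC₀_le_iff, nndist_toC₀_le_iff]
  refine ⟨fun h i => ?_, fun h i => ?_⟩
  · rcases lt_or_ge i l.length with hi | hi
    · simpa only [spread_apply_of_mem (List.getElem_mem hi), hl.idxOf_getElem i hi] using h l[i]
    · simp [hv i hi, hw i hi]
  · by_cases hi : i ∈ l
    · simpa only [spread_apply_of_mem hi] using h (l.idxOf i)
    · simp [spread_apply_of_notMem hi]

/-- The values of `Φ` at the first `l.length` terms of `x`, each spread along `l`. -/
noncomputable def valuesAlong {Y : Type*} (x : ℕ → ℕ →₀ ℤ) (Φ : (ι →₀ ℤ) → Y) (l : List ι) :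
    List Y :=
  (List.range l.length).map fun i => Φ (spread l (x i))

theorem valuesAlong_append_singleton {Y : Type*} {x : ℕ → ℕ →₀ ℤ}
    (hx : ∀ i j, i ≤ j → x i j = 0) {Φ : (ι →₀ ℤ) → Y} {n : ι} (hn : n ∉ l) :
    valuesAlong x Φ (l ++ [n]) = valuesAlong x Φ l ++ [Φ (spread (l ++ [n]) (x l.length))] := by
  rw [valuesAlong, List.length_append, List.length_singleton, List.range_succ, List.map_append]
  congr 1
  refine List.map_congr_left fun i hi => ?_
  rw [spread_append_singleton hn (hx i _ (List.mem_range.1 hi).le)]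

end Spread

section Transfer

variable {L : LadderSystem} {M : Type u} [MetricSpace M] {g : ℕ → ℕ} {x : ℕ → ℕ →₀ ℤ}

/-- The points `y` and `y'` are admissible values at `x i` and `x j` of a coarse embedding of
`c₀₀(ℕ; ℤ)` with gauge `g`. -/
def AdmissibleValues (g : ℕ → ℕ) (x : ℕ → ℕ →₀ ℤ) (i j : ℕ) (y y' : M) : Prop :=
  ComparableVia g (nndist (toC₀ (x i)) (toC₀ (x j))) (nndist y y')

theorem goodExtension_valuesAlong (hx : ∀ i j, i ≤ j → x i j = 0) {α : Ordinal.{0}} {N : ℕ+}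
    {Φ : C₀(ℕ+, ℝ) → M} (hΦ : ∀ v ∈ SchreierSpace L α, ∀ w ∈ SchreierSpace L α,
      ComparableVia g (nndist v w) (nndist (Φ v) (Φ w)))
    {l : List ℕ+} {n : ℕ+} (hln : l ++ [n] ∈ SchreierTree L α N) :
    GoodExtension (AdmissibleValues g x) (valuesAlong x (Φ ∘ toC₀) (l ++ [n]))
      (valuesAlong x (Φ ∘ toC₀) l) := by
  obtain ⟨hnodup, G, hG, hlG, -⟩ := hln
  have hn : n ∉ l := by simpa using List.disjoint_of_nodup_append hnodup
  refine ⟨⟨_, valuesAlong_append_singleton hx hn⟩, ?_⟩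
  generalize l ++ [n] = l' at *
  intro i j hi hj
  have hsupp : ∀ i < l'.length, ∀ k, l'.length ≤ k → x i k = 0 :=
    fun i hi k hk => hx i k (hi.le.trans hk)
  have hmem : ∀ i, toC₀ (spread l' (x i)) ∈ SchreierSpace L α := fun i =>
    toC₀_mem_schreierSpace hG (support_spread_subset.trans hlG)
  simp only [valuesAlong, List.length_map, List.length_range] at hi hj
  simpa [valuesAlong, AdmissibleValues, nndist_toC₀_spread hnodup (hsupp i hi) (hsupp j hj)]
    using hΦ _ (hmem i) _ (hmem j)

theorem exists_isGaugeEmbedding_c₀₀Int [Countable M]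
    (h : ∀ γ < ω₁, ∃ α ∈ Set.Ico γ ω₁, ∃ f : SchreierSpace L α → M, IsGaugeEmbedding g f) :
    ∃ f : c₀₀Int ℕ → M, IsGaugeEmbedding g f := by
  obtain ⟨x, hsurj, hx⟩ := exists_surjective_finsupp_eq_zero_of_le
  have hwf : ¬ WellFounded (GoodExtension (AdmissibleValues (M := M) g x)) := by
    refine not_wellFounded_of_schreierTree (L := L) (N := 1) (b := []) fun γ hγ => ?_
    obtain ⟨α, hα, f, hf⟩ := h γ hγ
    obtain ⟨Φ, hΦ⟩ := hf.exists_extension (schreierSpace_nonempty L hα.2)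
    exact ⟨α, hα, valuesAlong x (Φ ∘ toC₀), rfl, fun l n => goodExtension_valuesAlong hx hΦ⟩
  obtain ⟨u, hu⟩ := exists_branch_of_not_wellFounded hwf
  have hindex : ∀ v : c₀₀Int ℕ, ∃ i, toC₀ (x i) = v := by
    rintro ⟨_, v, rfl⟩
    exact (hsurj v).imp fun i hi => congrArg toC₀ hi
  choose index hindex using hindex
  refine ⟨fun v => u (index v), fun v w => ?_⟩
  simpa only [AdmissibleValues, hindex, Subtype.nndist_eq] using hu (index v) (index w)

theorem coarselyEmbeds_c₀₀Int_of_schreierSpace [TopologicalSpace.SeparableSpace M]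
    (h𝔟 : ℵ₁ < boundingNumber)
    (hM : ∀ γ < ω₁, ∃ α ∈ Set.Ico γ ω₁, CoarselyEmbeds (SchreierSpace L α) M) :
    CoarselyEmbeds (c₀₀Int ℕ) M := by
  obtain ⟨D, hcountable, hdense⟩ := TopologicalSpace.exists_countable_dense M
  have := hcountable.to_subtype
  have hgauge : ∀ γ < ω₁, ∃ g : ℕ → ℕ, ∃ α ∈ Set.Ico γ ω₁, ∃ f : SchreierSpace L α → D,
      IsGaugeEmbedding g f := fun γ hγ => by
    obtain ⟨α, hα, hemb⟩ := hM γ hγ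
    obtain ⟨g, f, hf⟩ := coarselyEmbeds_iff_exists_isGaugeEmbedding.1 (hemb.into_dense hdense)
    exact ⟨g, α, hα, f, hf⟩
  obtain ⟨g, hg⟩ := exists_forall_lt_omega_one_of_aleph_one_lt_boundingNumber h𝔟
    (fun g γ γ' hγ ⟨α, hα, hf⟩ => ⟨α, ⟨hγ.trans hα.1, hα.2⟩, hf⟩)
    (fun γ g g' hg ⟨α, hα, f, hf⟩ => ⟨α, hα, f, fun v w => (hf v w).mono hg⟩) hgauge
  obtain ⟨f, hf⟩ := exists_isGaugeEmbedding_c₀₀Int hg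
  exact (coarselyEmbeds_iff_exists_isGaugeEmbedding.2 ⟨g, f, hf⟩).trans
    (.of_isometry isometry_subtype_coe)

end Transfer

theorem theoremB_general (h𝔟 : ℵ₁ < boundingNumber) (L : LadderSystem) (M : Type u)
    [MetricSpace M] [TopologicalSpace.SeparableSpace M]
    (hM : ∀ γ < ω₁, ∃ α ∈ Set.Ico γ ω₁, CoarselyEmbeds (SchreierSpace L α) M) :
    CoarselyUniversalForSeparable.{u, v} M :=
  fun X _ _ => (coarselyEmbeds_c₀₀Int X).trans (coarselyEmbeds_c₀₀Int_of_schreierSpace h𝔟 hM)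

theorem theoremB (hMA : MartinsAxiom) (hCH : ¬ ContinuumHypothesis)
    (L : LadderSystem) (M : Type u) [MetricSpace M] [TopologicalSpace.SeparableSpace M]
    (hM : ∀ α < ω₁, CoarselyEmbeds (SchreierSpace L α) M) :
    CoarselyUniversalForSeparable.{u, v} M :=
  theoremB_general (hMA.aleph_one_lt_boundingNumber hCH) L M fun γ hγ => ⟨γ, ⟨le_rfl, hγ⟩, hM γ hγ⟩
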